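/- A tagged abelian group is an abelian group $(M,+,0)$ together with a sequence $(U_n)_{n\in\omega}$ of subgroups of $M$, regarded as a structure in the language $\{+,0\}\cup\{U_n:n\in\omega\}$ with unary predicates $U_n$. Countable structures are taken with universe $\omega$; for a language $L$ the $L$-structures with universe $\omega$ form a topological space whose subbasic open sets are the sets of structures deciding a single atomic fact $f(\bar x)=y$, $R(\bar x)$ or $\neg R(\bar x)$. A Borel class is a Borel, isomorphism-closed set of such structures. For classes $K,K'$ of such structures, $K\le_B K'$ means that there is a Borel map $f:K\to K'$ with $S\cong T\iff f(S)\cong f(T)$ for all $S,T\in K$. A class $K$ is Borel complete if it is a Borel class and $K'\le_B K$ for every Borel class $K'$ of structures in any countable language. **Theorem.** 1. The class of countable tagged abelian groups is Borel complete. 2. The class of tagged abelian groups whose underlying group is isomorphic to $\bigoplus_\omega\mathbb F_2$ is Borel complete. 3. Moreover, there are a fixed tagged abelian group $N=(\bigoplus_\omega\mathbb F_2,(V_n)_{n\in\omega})$ and a Borel map $G\mapsto U(G)$ from graphs with vertex set $\omega$ to subgroups of $\bigoplus_\omega\mathbb F_2$ (that is, $\{G: x\in U(G)\}$ is Borel for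 every $x$) such that for all graphs $G,H$ on $\omega$: $G\cong H$ if and only if $(N,U(G))\cong(N,U(H))$, i.e. if and only if some automorphism $\sigma$ of the group $\bigoplus_\omega\mathbb F_2$ satisfies $\sigma(V_n)=V_n$ for all $n$ and $\sigma(U(G))=U(H)$. -/

import Mathlib

open scoped DirectSum

/-! ## Spaces of countable structures and Borel reducibility

As usual in the Borel theory of countable models, "countable structure" means structure with
universe `ℕ`; the `L`-structures with universe `ℕ` form the space `L.Structure ℕ`. -/

/-- The usual topology on the space of `L`-structures with universe `M`, i.e. the product topology
of `∏_f M^(M^n) × ∏_R 2^(M^n)` with `M` and `2` discrete: it has as subbasis the sets of structures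
that decide one atomic fact `f(x) = y`, `R(x)` or `¬ R(x)`. -/
instance structureTopology (L : FirstOrder.Language.{0, 0}) (M : Type) : TopologicalSpace (L.Structure M) :=
  TopologicalSpace.generateFrom
    ({A | ∃ (n : ℕ) (f : L.Functions n) (x : Fin n → M) (y : M), A = {S | S.funMap f x = y}} ∪
      {A | ∃ (n : ℕ) (R : L.Relations n) (x : Fin n → M), A = {S | S.RelMap R x}} ∪
      {A | ∃ (n : ℕ) (R : L.Relations n) (x : Fin n → M), A = {S | ¬ S.RelMap R x}})

/-- Measurable sets and maps on the space of structures are the Borel ones. -/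
instance structureBorel (L : FirstOrder.Language.{0, 0}) (M : Type) : MeasurableSpace (L.Structure M) :=
  borel (L.Structure M)

/-- Two structures with universe `ℕ` are isomorphic. -/
def StrIso {L : FirstOrder.Language.{0, 0}} (S T : L.Structure ℕ) : Prop :=
  Nonempty (@FirstOrder.Language.Equiv L ℕ ℕ S T)

/-- A class of countable structures (given by its members with universe `ℕ`) that is Borel and
closed under isomorphism. -/
structure IsBorelClass {L : FirstOrder.Language.{0, 0}} (K : Set (L.Structure ℕ)) : Prop where
  measurableSet : MeasurableSet K
  iso_closed : ∀ S T : L.Structure ℕ, StrIso S T → S ∈ K → T ∈ K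

/-- `K ≤_B K'`: there is a Borel map `K → K'` that preserves and reflects isomorphism. -/
def BorelReducible {L L' : FirstOrder.Language.{0, 0}} (K : Set (L.Structure ℕ))
    (K' : Set (L'.Structure ℕ)) : Prop :=
  ∃ f : K → K', Measurable f ∧
    ∀ S T : K, StrIso (S : L.Structure ℕ) T ↔ StrIso (f S : L'.Structure ℕ) (f T)

/-- Borel completeness in the sense of Friedman and Stanley: `K` is a `≤_B`-maximum among the
isomorphism-closed Borel classes of countable structures in countable languages. -/
def IsBorelComplete {L : FirstOrder.Language.{0, 0}} (K : Set (L.Structure ℕ)) : Prop :=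
  IsBorelClass K ∧
    ∀ L' : FirstOrder.Language.{0, 0}, Countable L'.Symbols →
      ∀ K' : Set (L'.Structure ℕ), IsBorelClass K' → BorelReducible K' K

/-! ## Tagged abelian groups -/

/-- The function symbols `0` and `+`. -/
inductive TagFunctions : ℕ → Type
  | zero : TagFunctions 0
  | add : TagFunctions 2

/-- The unary predicate symbols `U_n`, `n ∈ ω`. -/
inductive TagRelations : ℕ → Type
  | tag (n : ℕ) : TagRelations 1

/-- The language `{+, 0} ∪ {U_n : n ∈ ω}`. -/
def tagLanguage : FirstOrder.Language.{0, 0} := ⟨TagFunctions, TagRelations⟩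

/-- The structure `S` is a tagged abelian group whose abelian group `(M, +, 0)` is the given one:
`+` and `0` are interpreted as in `M`, and every `U_n` is a subgroup. -/
def IsTaggedOn {M : Type} [AddCommGroup M] (S : tagLanguage.Structure M) : Prop :=
  S.funMap (n := 0) TagFunctions.zero ![] = 0 ∧
    (∀ x y : M, S.funMap (n := 2) TagFunctions.add ![x, y] = x + y) ∧
    ∀ i : ℕ, ∃ U : AddSubgroup M,
      ∀ x : M, x ∈ U ↔ S.RelMap (n := 1) (TagRelations.tag i) ![x]

/-- The class of countable tagged abelian groups. -/
def taggedGroups : Set (tagLanguage.Structure ℕ) :=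
  {S | ∃ A : AddCommGroup ℕ, @IsTaggedOn ℕ A S}

/-- The abelian group `M` is (isomorphic to) `⨁_ω 𝔽₂`. -/
def IsF2Sum (M : Type) [AddCommGroup M] : Prop :=
  Nonempty (M ≃+ ⨁ _ : ℕ, ZMod 2)

/-- The class of tagged abelian groups whose underlying group is (a copy on `ℕ` of)
`⨁_ω 𝔽₂`. -/
def taggedF2Groups : Set (tagLanguage.Structure ℕ) :=
  {S | ∃ A : AddCommGroup ℕ, @IsTaggedOn ℕ A S ∧ @IsF2Sum ℕ A}

/-!
The difficulty is to code a structure on `ℕ` by subgroups of an abelian group so that the addition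
of the group adds no isomorphisms, and so that every permutation of `ℕ` still lifts to a group
automorphism. Group rings of free groups do this.

Let `Γ = SwapGroup` be a free group mapping onto the finitary permutations of `ℕ`; its image is
dense in the Polish group of all permutations. Since subgroups of free groups are free
and nontrivial free groups map nontrivially to `ℤ`, the group `Γ` has unique products
(`FreeGroup.instTwoUniqueProds`), so that the group ring `A = 𝔽₂[Γ]` has no units besides the
elements of `Γ` (`MonoidAlgebra.eq_single_of_mul_eq_one`). Let `F` be the `𝔽₂`-vector space
with basis the finite tuples of natural numbers. In `LevelGroup = A × A × F`, name the zero
subgroup, the three factors, the graphs `{(a, a g, 0)}` of right multiplication by the elements `g`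
of `Γ`, and the graphs `{(a, 0, a t)}` of the orbit maps of the tuples `t`. An automorphism
respecting these countably many subgroups commutes with right multiplications, hence is left multiplication by a unit
of `A`, hence by an element of `Γ`, and acts on `F` in the same way (`exists_levelHom_of_mapsTo`).

Now let `seqGroup` consist of the sequences in `LevelGroup` that are eventually constant with
value in `F`. The fixed tags `coordTag n Q` name the subgroups of `LevelGroup` above in every
coordinate `n`. An automorphism fixing them is a sequence `(γ n)` in `Γ`, and as it maps
constant sequences to eventually constant ones, `(γ n)` converges to a permutation of `ℕ`
(`exists_swapConverges_of_map_coordTag`); by density, all permutations arise. A set `P` of tuples is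
coded by the subgroup `limitTag P` of sequences whose eventual value is supported in `P`, on which
the automorphism acts through the limit permutation only. So an automorphism that
fixes the tags `coordTag n Q` and carries `limitTag (P i)` to `limitTag (P' i)` for all `i` exists
if and only if some permutation of `ℕ` carries each `P i` to `P' i` (`exists_seqGroup_equiv_iff`).

A structure with universe `ℕ` is given by countably many sets of tuples, and a graph by
one, so this yields the reductions. They are Borel because membership of one sequence in
`limitTag P` depends on the finitely many tuples in the support of its eventual value. Finally
`seqGroup` is countably infinite of exponent two, hence isomorphic to `⨁ _ : ℕ, ZMod 2`.
-/

/-! ### Unique products in free groups and units of their group rings -/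

/-- A nontrivial free group maps nontrivially to `ℤ`. -/
theorem IsFreeGroup.exists_hom_int_ne_one (G : Type*) [Group G] [IsFreeGroup G] [Nontrivial G] :
    ∃ φ : G →* Multiplicative ℤ, φ ≠ 1 := by
  let e := IsFreeGroup.toFreeGroup G
  have hX : Nonempty (IsFreeGroup.Generators G) := by
    by_contra hX
    rw [not_nonempty_iff] at hX
    have : Subsingleton G := e.toEquiv.subsingleton
    exact not_subsingleton G this
  obtain ⟨x⟩ := hX
  refine ⟨(FreeGroup.lift fun _ => Multiplicative.ofAdd (1 : ℤ)).comp e.toMonoidHom, fun h => ?_⟩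
  have h1 := DFunLike.congr_fun h (e.symm (FreeGroup.of x))
  simp at h1

/-- Two finite subsets of a free group have a uniquely represented product: after translation they
lie in the subgroup `K` they generate, which is free, and a nontrivial homomorphism `K → ℤ`
cuts one of them down to a proper subset. -/
theorem IsFreeGroup.exists_uniqueMul {G : Type*} [Group G] [IsFreeGroup G] (n : ℕ) (A B : Finset G)
    (hn : A.card + B.card ≤ n) (hA : A.Nonempty) (hB : B.Nonempty) :
    ∃ a ∈ A, ∃ b ∈ B, UniqueMul A B a b := by
  classical
  induction n generalizing G with
  | zero =>
    have := hA.card_pos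
    omega
  | succ n ih =>
    by_cases hone : A.card ≤ 1 ∧ B.card ≤ 1
    · obtain ⟨a, ha⟩ := hA
      obtain ⟨b, hb⟩ := hB
      exact UniqueMul.of_card_le_one ⟨a, ha⟩ ⟨b, hb⟩ hone.1 hone.2
    obtain ⟨a₁, ha₁⟩ := hA
    obtain ⟨b₁, hb₁⟩ := hB
    let K := Subgroup.closure ({x | ∃ a ∈ A, x = a₁⁻¹ * a} ∪ {x | ∃ b ∈ B, x = b * b₁⁻¹})
    have hAK : ∀ a ∈ A, a₁⁻¹ * a ∈ K := fun a ha =>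
      Subgroup.subset_closure (Or.inl ⟨a, ha, rfl⟩)
    have hBK : ∀ b ∈ B, b * b₁⁻¹ ∈ K := fun b hb =>
      Subgroup.subset_closure (Or.inr ⟨b, hb, rfl⟩)
    have hK : Nontrivial K := by
      by_contra hK
      rw [not_nontrivial_iff_subsingleton] at hK
      have key : ∀ x ∈ K, x = 1 := fun x hx =>
        congrArg Subtype.val (Subsingleton.elim (⟨x, hx⟩ : K) 1)
      refine hone ⟨Finset.card_le_one.2 fun x hx y hy => ?_,
        Finset.card_le_one.2 fun x hx y hy => ?_⟩
      · rw [← inv_mul_eq_one.1 (key _ (hAK x hx)), ← inv_mul_eq_one.1 (key _ (hAK y hy))]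
      · rw [mul_inv_eq_one.1 (key _ (hBK x hx)), mul_inv_eq_one.1 (key _ (hBK y hy))]
    obtain ⟨φ, hφ⟩ := IsFreeGroup.exists_hom_int_ne_one K
    let A' : Finset K := A.attach.image fun a : {x // x ∈ A} => ⟨a₁⁻¹ * a.1, hAK a.1 a.2⟩
    let B' : Finset K := B.attach.image fun b : {x // x ∈ B} => ⟨b.1 * b₁⁻¹, hBK b.1 b.2⟩
    have hA'mem : ∀ a (ha : a ∈ A), (⟨a₁⁻¹ * a, hAK a ha⟩ : K) ∈ A' := fun a ha =>
      Finset.mem_image.2 ⟨⟨a, ha⟩, Finset.mem_attach _ _, rfl⟩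
    have hB'mem : ∀ b (hb : b ∈ B), (⟨b * b₁⁻¹, hBK b hb⟩ : K) ∈ B' := fun b hb =>
      Finset.mem_image.2 ⟨⟨b, hb⟩, Finset.mem_attach _ _, rfl⟩
    have h1A : (1 : K) ∈ A' := by
      convert hA'mem a₁ ha₁ using 1
      ext; simp
    have h1B : (1 : K) ∈ B' := by
      convert hB'mem b₁ hb₁ using 1
      ext; simp
    have hcA : A'.card ≤ A.card := Finset.card_image_le.trans (by simp)
    have hcB : B'.card ≤ B.card := Finset.card_image_le.trans (by simp)
    have hnt : (∃ x ∈ A', φ x ≠ 1) ∨ ∃ x ∈ B', φ x ≠ 1 := by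
      by_contra! hcon
      refine hφ (MonoidHom.ext fun ⟨x, hx⟩ => ?_)
      have hle : K ≤ φ.ker.map K.subtype := by
        refine (Subgroup.closure_le _).2 ?_
        rintro _ (⟨a, ha, rfl⟩ | ⟨b, hb, rfl⟩)
        · exact ⟨_, hcon.1 _ (hA'mem a ha), rfl⟩
        · exact ⟨_, hcon.2 _ (hB'mem b hb), rfl⟩
      obtain ⟨y, hy, hyx⟩ := hle hx
      have : y = ⟨x, hx⟩ := Subtype.ext hyx
      rw [← this]
      exact hy
    obtain ⟨p, hp, q, hq, hpq⟩ := UniqueProds.uniqueMul_of_nonempty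
      (A := A'.image φ) (B := B'.image φ) ⟨_, Finset.mem_image_of_mem φ h1A⟩
      ⟨_, Finset.mem_image_of_mem φ h1B⟩
    -- The fibres over `p` and `q` are nonempty, and one of them is a proper subset.
    obtain ⟨x, hx, rfl⟩ := Finset.mem_image.1 hp
    obtain ⟨y, hy, rfl⟩ := Finset.mem_image.1 hq
    have hlt : ∀ (S : Finset K) (z : K), 1 ∈ S → (∃ x ∈ S, φ x ≠ 1) →
        (S.filter (φ · = φ z)).card < S.card := by
      rintro S z h1 ⟨x, hx, hx1⟩
      refine Finset.card_lt_card (Finset.filter_ssubset.2 ?_)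
      by_cases hz : φ z = 1
      · exact ⟨x, hx, by rw [hz]; exact hx1⟩
      · exact ⟨1, h1, by rw [map_one]; exact fun h => hz h.symm⟩
    have hfA := Finset.card_filter_le A' (φ · = φ x)
    have hfB := Finset.card_filter_le B' (φ · = φ y)
    have hcard : (A'.filter (φ · = φ x)).card + (B'.filter (φ · = φ y)).card ≤ n := by
      rcases hnt with h | h
      · have := hlt A' x h1A h
        omega
      · have := hlt B' y h1B h
        omega
    obtain ⟨a, ha, b, hb, hab⟩ := ih _ _ hcard ⟨x, Finset.mem_filter.2 ⟨hx, rfl⟩⟩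
      ⟨y, Finset.mem_filter.2 ⟨hy, rfl⟩⟩
    rw [Finset.mem_filter] at ha hb
    have huniq : UniqueMul A' B' a b :=
      UniqueMul.of_image_filter (φ : K →ₙ* Multiplicative ℤ) ha.2 hb.2 hpq hab
    obtain ⟨⟨a₀, ha₀⟩, -, rfl⟩ := Finset.mem_image.1 ha.1
    obtain ⟨⟨b₀, hb₀⟩, -, rfl⟩ := Finset.mem_image.1 hb.1
    refine ⟨a₀, ha₀, b₀, hb₀, fun c d hc hd hcd => ?_⟩
    have := huniq (hA'mem c hc) (hB'mem d hd) (Subtype.ext (by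
      simp only [Subgroup.coe_mul]
      calc a₁⁻¹ * c * (d * b₁⁻¹) = a₁⁻¹ * (c * d) * b₁⁻¹ := by group
        _ = a₁⁻¹ * (a₀ * b₀) * b₁⁻¹ := by rw [hcd]
        _ = a₁⁻¹ * a₀ * (b₀ * b₁⁻¹) := by group))
    simpa using this

instance FreeGroup.instTwoUniqueProds (α : Type*) : TwoUniqueProds (FreeGroup α) :=
  have : UniqueProds (FreeGroup α) :=
    ⟨fun {A B} hA hB => IsFreeGroup.exists_uniqueMul _ A B le_rfl hA hB⟩
  UniqueProds.toTwoUniqueProds_of_group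

/-- Over `𝔽₂`, one-sided invertible elements of the monoid algebra of a monoid with
two unique products are monomials. -/
theorem MonoidAlgebra.eq_single_of_mul_eq_one {M : Type*} [Monoid M] [TwoUniqueProds M]
    {u v : MonoidAlgebra (ZMod 2) M} (h : u * v = 1) : ∃ g, u = MonoidAlgebra.single g 1 := by
  classical
  have hval : ∀ r : ZMod 2, r ≠ 0 → r = 1 := by decide
  have hu : u ≠ 0 := by
    rintro rfl
    simp at h
  have hv : v ≠ 0 := by
    rintro rfl
    simp at h
  have hu' : 0 < u.coeff.support.card := by
    rw [Finset.card_pos, Finsupp.support_nonempty_iff]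
    simpa using hu
  have hv' : 0 < v.coeff.support.card := by
    rw [Finset.card_pos, Finsupp.support_nonempty_iff]
    simpa using hv
  have hcard : u.coeff.support.card = 1 := by
    by_contra hne
    have h1 : 1 < u.coeff.support.card * v.coeff.support.card := by
      have : 2 ≤ u.coeff.support.card := by omega
      nlinarith
    obtain ⟨p, hp, q, hq, hpq, hup, huq⟩ := TwoUniqueProds.uniqueMul_of_one_lt_card h1
    rw [Finset.mem_product] at hp hq
    -- A uniquely represented product occurs in `u * v = 1`, hence equals `1`.
    have key : ∀ p : M × M, p.1 ∈ u.coeff.support → p.2 ∈ v.coeff.support →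
        UniqueMul u.coeff.support v.coeff.support p.1 p.2 → p.1 * p.2 = 1 := by
      intro p h1 h2 h3
      have h4 := MonoidAlgebra.coeff_mul_mul_of_uniqueMul h3
      rw [hval _ (Finsupp.mem_support_iff.1 h1), hval _ (Finsupp.mem_support_iff.1 h2), h,
        MonoidAlgebra.one_def, MonoidAlgebra.coeff_single, Finsupp.single_apply] at h4
      by_contra h5
      rw [if_neg (Ne.symm h5)] at h4
      simp at h4
    have h2 := hup hq.1 hq.2 ((key q hq.1 hq.2 huq).trans (key p hp.1 hp.2 hup).symm)
    exact hpq (Prod.ext h2.1.symm h2.2.symm)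
  obtain ⟨g, hg, hg'⟩ := Finsupp.card_support_eq_one.1 hcard
  refine ⟨g, MonoidAlgebra.ext ?_⟩
  rw [hg', hval _ hg, MonoidAlgebra.coeff_single]

/-! ### A countable dense group of permutations -/

/-- The free group on the pairs `(i, j)` of natural numbers, thought of as transpositions of `ℕ`. -/
abbrev SwapGroup : Type := FreeGroup (ℕ × ℕ)

/-- The action of `SwapGroup` on `ℕ`: the generator `(i, j)` acts as the transposition `(i j)`. -/
def swapPerm : SwapGroup →* Equiv.Perm ℕ := FreeGroup.lift fun p => Equiv.swap p.1 p.2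

theorem exists_swapPerm_eqOn (π : Equiv.Perm ℕ) (s : Finset ℕ) :
    ∃ g : SwapGroup, ∀ x ∈ s, swapPerm g x = π x := by
  induction s using Finset.induction_on with
  | empty => exact ⟨1, by simp⟩
  | insert a s ha ih =>
    obtain ⟨g, hg⟩ := ih
    refine ⟨FreeGroup.of (swapPerm g a, π a) * g, fun x hx => ?_⟩
    have hmul : swapPerm (FreeGroup.of (swapPerm g a, π a) * g) x =
        Equiv.swap (swapPerm g a) (π a) (swapPerm g x) := by
      simp [swapPerm]
    rw [hmul]
    rcases Finset.mem_insert.1 hx with rfl | hx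
    · exact Equiv.swap_apply_left _ _
    · have hxa : x ≠ a := fun h => ha (h ▸ hx)
      rw [Equiv.swap_apply_of_ne_of_ne ((swapPerm g).injective.ne hxa)
        (by rw [hg x hx]; exact π.injective.ne hxa), hg x hx]

/-- `SwapGroup` has dense image in the group of permutations of `ℕ`. -/
theorem exists_swapPerm_tendsto (π : Equiv.Perm ℕ) : ∃ g : ℕ → SwapGroup,
    ∀ x, ∀ᶠ n in Filter.atTop, swapPerm (g n) x = π x ∧ swapPerm (g n)⁻¹ x = π.symm x := by
  choose g hg using fun n : ℕ =>
    exists_swapPerm_eqOn π (Finset.range n ∪ (Finset.range n).image π.symm)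
  refine ⟨g, fun x => Filter.eventually_atTop.2 ⟨x + 1, fun n hn => ?_⟩⟩
  have hx : x ∈ Finset.range n := Finset.mem_range.2 (by omega)
  refine ⟨hg n x (Finset.mem_union_left _ hx), ?_⟩
  have h := hg n _ (Finset.mem_union_right _ (Finset.mem_image_of_mem π.symm hx))
  rw [Equiv.apply_symm_apply] at h
  rw [map_inv, Equiv.Perm.inv_eq_iff_eq, h]

/-! ### The group at one coordinate and its automorphisms -/

/-- The group ring `𝔽₂[SwapGroup]`. -/
abbrev SwapRing : Type := MonoidAlgebra (ZMod 2) SwapGroup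

/-- The `𝔽₂`-vector space with basis the finite tuples of natural numbers. -/
abbrev TupleSpace : Type := List ℕ →₀ ZMod 2

/-- The group sitting at each coordinate: two copies of the group ring and the tuple space. -/
abbrev LevelGroup : Type := SwapRing × SwapRing × TupleSpace

/-- The entrywise action of a permutation of `ℕ` on the tuple space. -/
noncomputable def tupleMap (π : Equiv.Perm ℕ) : TupleSpace ≃+ TupleSpace :=
  Finsupp.domCongr (Equiv.listEquivOfEquiv π)

theorem tupleMap_single (π : Equiv.Perm ℕ) (t : List ℕ) (r : ZMod 2) :
    tupleMap π (Finsupp.single t r) = Finsupp.single (t.map π) r := by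
  simp [tupleMap, Finsupp.domCongr, Equiv.listEquivOfEquiv]

/-- The map `a ↦ a • t` from the group ring to the tuple space. -/
noncomputable def orbitMap (t : List ℕ) : SwapRing →+ TupleSpace :=
  (Finsupp.mapDomain.addMonoidHom fun g : SwapGroup => t.map (swapPerm g)).comp
    MonoidAlgebra.coeffAddEquiv.toAddMonoidHom

theorem orbitMap_single (t : List ℕ) (g : SwapGroup) (r : ZMod 2) :
    orbitMap t (MonoidAlgebra.single g r) = Finsupp.single (t.map (swapPerm g)) r := by
  simp [orbitMap]

theorem orbitMap_single_mul (t : List ℕ) (g : SwapGroup) (a : SwapRing) :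
    orbitMap t (MonoidAlgebra.single g 1 * a) = tupleMap (swapPerm g) (orbitMap t a) := by
  have h : (orbitMap t).comp (AddMonoidHom.mulLeft (MonoidAlgebra.single g 1)) =
      (tupleMap (swapPerm g)).toAddMonoidHom.comp (orbitMap t) := by
    refine MonoidAlgebra.addMonoidHom_ext fun x r => ?_
    simp [orbitMap_single, tupleMap_single, MonoidAlgebra.single_mul_single, Function.comp_def]
  exact DFunLike.congr_fun h a

/-- The action of an element of `SwapGroup` on `LevelGroup`: multiplication from the left on the
copies of the group ring, and the entrywise action on tuples. -/
noncomputable def levelHom (g : SwapGroup) : LevelGroup →+ LevelGroup :=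
  (AddMonoidHom.mulLeft (MonoidAlgebra.single g 1)).prodMap
    ((AddMonoidHom.mulLeft (MonoidAlgebra.single g 1)).prodMap
      (tupleMap (swapPerm g)).toAddMonoidHom)

theorem levelHom_apply (g : SwapGroup) (d : LevelGroup) : levelHom g d =
    (MonoidAlgebra.single g 1 * d.1, MonoidAlgebra.single g 1 * d.2.1,
      tupleMap (swapPerm g) d.2.2) := rfl

theorem levelHom_inv_levelHom (g : SwapGroup) (d : LevelGroup) :
    levelHom g⁻¹ (levelHom g d) = d := by
  simp only [levelHom_apply, ← mul_assoc, MonoidAlgebra.single_mul_single, inv_mul_cancel, mul_one]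
  have h : tupleMap (swapPerm g⁻¹) (tupleMap (swapPerm g) d.2.2) = d.2.2 := by
    rw [map_inv]
    exact (tupleMap (swapPerm g)).symm_apply_apply d.2.2
  rw [h, ← MonoidAlgebra.one_def, one_mul, one_mul]

theorem levelHom_levelHom_inv (g : SwapGroup) (d : LevelGroup) :
    levelHom g (levelHom g⁻¹ d) = d := by
  simpa using levelHom_inv_levelHom g⁻¹ d

/-- The graph of right multiplication by `g`, from the first to the second copy of the
group ring. -/
noncomputable def mulTag (g : SwapGroup) : AddSubgroup LevelGroup :=
  ((AddMonoidHom.id SwapRing).prod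
    ((AddMonoidHom.mulRight (MonoidAlgebra.single g 1)).prod 0)).range

/-- The graph of `a ↦ a • t`, from the first copy of the group ring to the tuple space. -/
noncomputable def orbitTag (t : List ℕ) : AddSubgroup LevelGroup :=
  ((AddMonoidHom.id SwapRing).prod ((0 : SwapRing →+ SwapRing).prod (orbitMap t))).range

/-- The subgroups named at each coordinate: they make `LevelGroup` a structure whose
automorphism group is `SwapGroup`. -/
def levelTags : Set (AddSubgroup LevelGroup) :=
  {⊥, AddSubgroup.prod ⊤ (AddSubgroup.prod ⊥ ⊥), AddSubgroup.prod ⊥ (AddSubgroup.prod ⊤ ⊥),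
    AddSubgroup.prod ⊥ (AddSubgroup.prod ⊥ ⊤)} ∪ Set.range mulTag ∪ Set.range orbitTag

theorem levelTags_countable : levelTags.Countable :=
  ((Set.toFinite _).countable.union (Set.countable_range _)).union (Set.countable_range _)

theorem mem_mulTag {g : SwapGroup} {d : LevelGroup} :
    d ∈ mulTag g ↔ d.2.1 = d.1 * MonoidAlgebra.single g 1 ∧ d.2.2 = 0 := by
  obtain ⟨a, b, c⟩ := d
  constructor
  · rintro ⟨x, hx⟩
    obtain ⟨rfl, rfl, rfl⟩ : x = a ∧ x * MonoidAlgebra.single g 1 = b ∧ 0 = c := by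
      simpa using hx
    exact ⟨rfl, rfl⟩
  · rintro ⟨h₁, h₂⟩
    dsimp only at h₁ h₂
    subst h₁ h₂
    exact ⟨a, rfl⟩

theorem mem_orbitTag {t : List ℕ} {d : LevelGroup} :
    d ∈ orbitTag t ↔ d.2.1 = 0 ∧ d.2.2 = orbitMap t d.1 := by
  obtain ⟨a, b, c⟩ := d
  constructor
  · rintro ⟨x, hx⟩
    obtain ⟨rfl, rfl, rfl⟩ : x = a ∧ 0 = b ∧ orbitMap t x = c := by
      simpa using hx
    exact ⟨rfl, rfl⟩
  · rintro ⟨h₁, h₂⟩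
    dsimp only at h₁ h₂
    subst h₁ h₂
    exact ⟨a, rfl⟩

theorem levelHom_mem {Q : AddSubgroup LevelGroup} (hQ : Q ∈ levelTags) (g : SwapGroup)
    {d : LevelGroup} (hd : d ∈ Q) : levelHom g d ∈ Q := by
  rcases hQ with ((rfl | rfl | rfl | rfl) | ⟨h, rfl⟩) | ⟨t, rfl⟩
  · rw [AddSubgroup.mem_bot] at hd
    rw [hd, map_zero]
    exact zero_mem _
  · simp only [AddSubgroup.mem_prod, AddSubgroup.mem_bot, levelHom_apply] at hd ⊢
    simp [hd]
  · simp only [AddSubgroup.mem_prod, AddSubgroup.mem_bot, levelHom_apply] at hd ⊢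
    simp [hd]
  · simp only [AddSubgroup.mem_prod, AddSubgroup.mem_bot, levelHom_apply] at hd ⊢
    simp [hd]
  · rw [mem_mulTag] at hd ⊢
    simp [levelHom_apply, hd, mul_assoc]
  · rw [mem_orbitTag] at hd ⊢
    simp [levelHom_apply, hd, orbitMap_single_mul]

/-- Every automorphism of `LevelGroup` that respects the named subgroups is the action of some
element of `SwapGroup`: on the group ring it commutes with right multiplications, so it is left
multiplication by a unit, and all units of `𝔽₂[SwapGroup]` are trivial. -/
theorem exists_levelHom_of_mapsTo (σ : LevelGroup ≃+ LevelGroup)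
    (h : ∀ Q ∈ levelTags, ∀ d ∈ Q, σ d ∈ Q) (h' : ∀ Q ∈ levelTags, ∀ d ∈ Q, σ.symm d ∈ Q) :
    ∃ g : SwapGroup, ∀ d, σ d = levelHom g d := by
  -- On the first copy of the group ring, `τ` is left multiplication by `(τ (1, 0, 0)).1`.
  have key : ∀ τ : LevelGroup ≃+ LevelGroup, (∀ Q ∈ levelTags, ∀ d ∈ Q, τ d ∈ Q) →
      (∀ a, τ (a, 0, 0) = ((τ (1, 0, 0)).1 * a, 0, 0)) ∧
      (∀ a, τ (0, a, 0) = (0, (τ (1, 0, 0)).1 * a, 0)) ∧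
      (∀ c, (τ (0, 0, c)).1 = 0 ∧ (τ (0, 0, c)).2.1 = 0) ∧
      (∀ t a, (τ (0, 0, orbitMap t a)).2.2 = orbitMap t ((τ (1, 0, 0)).1 * a)) := by
    intro τ hτ
    have h1 : ∀ a, (τ (a, 0, 0)).2.1 = 0 ∧ (τ (a, 0, 0)).2.2 = 0 := fun a => by
      simpa [AddSubgroup.mem_prod, Prod.ext_iff] using hτ _
        (Or.inl (Or.inl (Or.inr (Or.inl rfl)))) (a, 0, 0) (by simp [AddSubgroup.mem_prod])
    have h2 : ∀ a, (τ (0, a, 0)).1 = 0 ∧ (τ (0, a, 0)).2.2 = 0 := fun a => by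
      simpa [AddSubgroup.mem_prod] using hτ _
        (Or.inl (Or.inl (Or.inr (Or.inr (Or.inl rfl))))) (0, a, 0) (by simp [AddSubgroup.mem_prod])
    have h3 : ∀ c, (τ (0, 0, c)).1 = 0 ∧ (τ (0, 0, c)).2.1 = 0 := fun c => by
      simpa [AddSubgroup.mem_prod] using hτ _
        (Or.inl (Or.inl (Or.inr (Or.inr (Or.inr rfl))))) (0, 0, c) (by simp [AddSubgroup.mem_prod])
    have h4 : ∀ g a, (τ (0, a * MonoidAlgebra.single g 1, 0)).2.1 =
        (τ (a, 0, 0)).1 * MonoidAlgebra.single g 1 := fun g a => by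
      have h5 := hτ _ (Or.inl (Or.inr ⟨g, rfl⟩)) (a, a * MonoidAlgebra.single g 1, 0)
        (mem_mulTag.2 ⟨rfl, rfl⟩)
      have h6 : ((a, a * MonoidAlgebra.single g 1, 0) : LevelGroup) =
          (a, 0, 0) + (0, a * MonoidAlgebra.single g 1, 0) := by simp
      rw [h6, map_add, mem_mulTag] at h5
      simpa [h1, h2] using h5.1
    have h5 : ∀ a, (τ (0, a, 0)).2.1 = (τ (a, 0, 0)).1 := fun a => by
      simpa [← MonoidAlgebra.one_def] using h4 1 a
    have h6 : ∀ a, (τ (a, 0, 0)).1 = (τ (1, 0, 0)).1 * a := by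
      have h7 : ((AddMonoidHom.fst SwapRing (SwapRing × TupleSpace)).comp τ.toAddMonoidHom).comp
          (AddMonoidHom.inl SwapRing (SwapRing × TupleSpace)) =
          AddMonoidHom.mulLeft (τ (1, 0, 0)).1 := by
        refine MonoidAlgebra.addMonoidHom_ext fun g r => ?_
        have hr : r = 0 ∨ r = 1 := by
          revert r
          decide
        rcases hr with rfl | rfl
        · rw [MonoidAlgebra.single_zero, map_zero, map_zero]
        · have h8 := h4 g 1
          rw [one_mul, h5] at h8
          exact h8
      exact fun a => DFunLike.congr_fun h7 a
    refine ⟨fun a => ?_, fun a => ?_, h3, fun t a => ?_⟩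
    · rw [← h6]
      exact Prod.ext rfl (Prod.ext (h1 a).1 (h1 a).2)
    · rw [← h6, ← h5]
      exact Prod.ext (h2 a).1 (Prod.ext rfl (h2 a).2)
    · have h7 := hτ _ (Or.inr ⟨t, rfl⟩) (a, 0, orbitMap t a) (mem_orbitTag.2 ⟨rfl, rfl⟩)
      have h8 : ((a, 0, orbitMap t a) : LevelGroup) = (a, 0, 0) + (0, 0, orbitMap t a) := by simp
      rw [h8, map_add, mem_orbitTag] at h7
      rw [← h6]
      simpa [h1, h3] using h7.2
  obtain ⟨hl, hr, h0, ht⟩ := key σ h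
  obtain ⟨hl', -, -, -⟩ := key σ.symm h'
  have huv : (σ (1, 0, 0)).1 * (σ.symm (1, 0, 0)).1 = 1 := by
    have h1 := σ.apply_symm_apply (1, 0, 0)
    rw [hl' 1, hl, mul_one] at h1
    exact congrArg Prod.fst h1
  obtain ⟨g, hg⟩ := MonoidAlgebra.eq_single_of_mul_eq_one huv
  rw [hg] at hl hr ht
  have htup : ∀ c, σ (0, 0, c) = (0, 0, tupleMap (swapPerm g) c) := by
    intro c
    refine Prod.ext (h0 c).1 (Prod.ext (h0 c).2 ?_)
    change (σ (0, 0, c)).2.2 = tupleMap (swapPerm g) c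
    induction c using Finsupp.induction_linear with
    | zero =>
      rw [show ((0, 0, 0) : LevelGroup) = 0 from rfl, map_zero, map_zero]
      rfl
    | add c d hc hd =>
      have : ((0, 0, c + d) : LevelGroup) = (0, 0, c) + (0, 0, d) := by simp
      rw [this, map_add, Prod.snd_add, Prod.snd_add, hc, hd, map_add]
    | single t r =>
      have h1 := ht t (MonoidAlgebra.single 1 r)
      rw [orbitMap_single_mul, orbitMap_single] at h1
      simpa using h1
  refine ⟨g, fun ⟨a, b, c⟩ => ?_⟩
  have : ((a, b, c) : LevelGroup) = (a, 0, 0) + ((0, b, 0) + (0, 0, c)) := by simp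
  rw [this, map_add, map_add, hl, hr, htup]
  simp [levelHom_apply]

/-! ### Eventually constant sequences and permutations of the natural numbers -/

open Filter in
/-- The underlying group of the fixed tagged group: sequences in `LevelGroup` that are eventually
constant with value in the tuple space. -/
noncomputable def seqGroup : AddSubgroup (ℕ → LevelGroup) where
  carrier := {w | ∃ c : TupleSpace, ∀ᶠ n in atTop, w n = (0, 0, c)}
  zero_mem' := ⟨0, Eventually.of_forall fun _ => rfl⟩
  add_mem' := by
    rintro v w ⟨c, hc⟩ ⟨d, hd⟩
    refine ⟨c + d, ?_⟩
    filter_upwards [hc, hd] with n h1 h2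
    simp [h1, h2]
  neg_mem' := by
    rintro w ⟨c, hc⟩
    refine ⟨-c, ?_⟩
    filter_upwards [hc] with n h1
    simp [h1]

/-- The `n`-th coordinate of a sequence. -/
noncomputable def coordHom (n : ℕ) : seqGroup →+ LevelGroup :=
  (Pi.evalAddMonoidHom (fun _ => LevelGroup) n).comp seqGroup.subtype

theorem seqGroup_ext {v w : seqGroup} (h : ∀ n, coordHom n v = coordHom n w) : v = w :=
  Subtype.ext (funext h)

/-- The sequence with value `d` at `n` and `0` elsewhere. -/
noncomputable def bump (n : ℕ) : LevelGroup →+ seqGroup :=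
  (AddMonoidHom.single (fun _ : ℕ => LevelGroup) n).codRestrict seqGroup fun d =>
    ⟨0, Filter.eventually_atTop.2 ⟨n + 1, fun m hm =>
      Pi.single_eq_of_ne (M := fun _ : ℕ => LevelGroup) (by omega) d⟩⟩

theorem coordHom_bump (n : ℕ) (d : LevelGroup) : coordHom n (bump n d) = d :=
  Pi.single_eq_same (M := fun _ : ℕ => LevelGroup) n d

/-- The constant sequence at a basis element of the tuple space. -/
noncomputable def constTuple (t : List ℕ) : seqGroup :=
  ⟨fun _ => (0, 0, Finsupp.single t 1), _, Filter.Eventually.of_forall fun _ => rfl⟩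

theorem coordHom_constTuple (n : ℕ) (t : List ℕ) :
    coordHom n (constTuple t) = (0, 0, Finsupp.single t 1) := rfl

/-- The sequences whose `n`-th coordinate lies in `Q`. -/
noncomputable def coordTag (n : ℕ) (Q : AddSubgroup LevelGroup) : AddSubgroup seqGroup :=
  Q.comap (coordHom n)

/-- The sequences whose eventual value is a combination of tuples in `P`. -/
noncomputable def limitTag (P : Set (List ℕ)) : AddSubgroup seqGroup where
  carrier := {w | ∃ c ∈ Finsupp.supported (ZMod 2) (ZMod 2) P,
    ∀ᶠ n in Filter.atTop, coordHom n w = (0, 0, c)}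
  zero_mem' := ⟨0, zero_mem _, Filter.Eventually.of_forall fun _ => rfl⟩
  add_mem' := by
    rintro v w ⟨c, hcP, hc⟩ ⟨d, hdP, hd⟩
    refine ⟨c + d, add_mem hcP hdP, ?_⟩
    filter_upwards [hc, hd] with n h1 h2
    simp [h1, h2]
  neg_mem' := by
    rintro w ⟨c, hcP, hc⟩
    refine ⟨-c, neg_mem hcP, ?_⟩
    filter_upwards [hc] with n h1
    simp [h1]

theorem mem_limitTag_iff_of_eventually {P : Set (List ℕ)} {w : seqGroup} {c : TupleSpace}
    (hc : ∀ᶠ n in Filter.atTop, coordHom n w = (0, 0, c)) :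
    w ∈ limitTag P ↔ ∀ t ∈ c.support, t ∈ P := by
  constructor
  · rintro ⟨d, hdP, hd⟩
    obtain ⟨n, h1, h2⟩ := (hc.and hd).exists
    obtain rfl : c = d := by
      rw [h1] at h2
      simpa using h2
    exact fun t ht => (Finsupp.mem_supported _ _).1 hdP (Finset.mem_coe.2 ht)
  · exact fun h => ⟨c, (Finsupp.mem_supported _ _).2 fun t ht => h t (Finset.mem_coe.1 ht), hc⟩

theorem constTuple_mem_limitTag {P : Set (List ℕ)} {t : List ℕ} :
    constTuple t ∈ limitTag P ↔ t ∈ P := by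
  rw [mem_limitTag_iff_of_eventually (c := Finsupp.single t 1)
    (Filter.Eventually.of_forall fun n => coordHom_constTuple n t)]
  simp

/-- The sequence of permutations given by `g` converges to `π` in the Polish group of
permutations of `ℕ`. -/
def SwapConverges (g : ℕ → SwapGroup) (π : Equiv.Perm ℕ) : Prop :=
  ∀ x, ∀ᶠ n in Filter.atTop, swapPerm (g n) x = π x ∧ swapPerm (g n)⁻¹ x = π.symm x

theorem SwapConverges.inv {g : ℕ → SwapGroup} {π : Equiv.Perm ℕ} (h : SwapConverges g π) :
    SwapConverges (fun n => (g n)⁻¹) π.symm := fun x => by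
  filter_upwards [h x] with n hn
  exact ⟨hn.2, by rw [inv_inv]; exact hn.1⟩

theorem SwapConverges.eventually_map {g : ℕ → SwapGroup} {π : Equiv.Perm ℕ}
    (h : SwapConverges g π) (t : List ℕ) :
    ∀ᶠ n in Filter.atTop, t.map (swapPerm (g n)) = t.map π := by
  have h1 : ∀ᶠ n in Filter.atTop, ∀ x ∈ {x | x ∈ t}, swapPerm (g n) x = π x :=
    (Filter.eventually_all_finite t.finite_toSet).2 fun x _ => (h x).mono fun _ hn => hn.1
  exact h1.mono fun n hn => List.map_congr_left hn

theorem SwapConverges.eventually_tupleMap {g : ℕ → SwapGroup} {π : Equiv.Perm ℕ}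
    (h : SwapConverges g π) (c : TupleSpace) :
    ∀ᶠ n in Filter.atTop, tupleMap (swapPerm (g n)) c = tupleMap π c := by
  induction c using Finsupp.induction_linear with
  | zero => exact Filter.Eventually.of_forall fun n => by rw [map_zero, map_zero]
  | add c d hc hd =>
    filter_upwards [hc, hd] with n h1 h2
    rw [map_add, map_add, h1, h2]
  | single t r =>
    filter_upwards [h.eventually_map t] with n hn
    rw [tupleMap_single, tupleMap_single, hn]

theorem SwapConverges.eventually_levelHom {g : ℕ → SwapGroup} {π : Equiv.Perm ℕ}
    (h : SwapConverges g π) {w : ℕ → LevelGroup} {c : TupleSpace}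
    (hw : ∀ᶠ n in Filter.atTop, w n = (0, 0, c)) :
    ∀ᶠ n in Filter.atTop, levelHom (g n) (w n) = (0, 0, tupleMap π c) := by
  filter_upwards [hw, h.eventually_tupleMap c] with n h1 h2
  rw [h1, levelHom_apply]
  simp [h2]

/-- The automorphism of `seqGroup` acting at coordinate `n` as `g n`; convergence of `g` is what
keeps sequences eventually constant. -/
noncomputable def seqAut (g : ℕ → SwapGroup) (π : Equiv.Perm ℕ) (h : SwapConverges g π) :
    seqGroup ≃+ seqGroup where
  toFun w := ⟨fun n => levelHom (g n) (coordHom n w), by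
    obtain ⟨c, hc⟩ := w.2
    exact ⟨_, h.eventually_levelHom hc⟩⟩
  invFun w := ⟨fun n => levelHom (g n)⁻¹ (coordHom n w), by
    obtain ⟨c, hc⟩ := w.2
    exact ⟨_, h.inv.eventually_levelHom hc⟩⟩
  left_inv w := seqGroup_ext fun n => levelHom_inv_levelHom (g n) _
  right_inv w := seqGroup_ext fun n => levelHom_levelHom_inv (g n) _
  map_add' v w := seqGroup_ext fun n => by
    change levelHom (g n) (coordHom n (v + w)) =
      levelHom (g n) (coordHom n v) + levelHom (g n) (coordHom n w)
    rw [map_add, map_add]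

theorem map_coordTag_of_levelHom {σ : seqGroup ≃+ seqGroup} {g : ℕ → SwapGroup}
    (hσ : ∀ n w, coordHom n (σ w) = levelHom (g n) (coordHom n w)) (n : ℕ)
    {Q : AddSubgroup LevelGroup} (hQ : Q ∈ levelTags) :
    (coordTag n Q).map σ.toAddMonoidHom = coordTag n Q := by
  ext w
  constructor
  · rintro ⟨v, hv, rfl⟩
    change coordHom n (σ v) ∈ Q
    rw [hσ]
    exact levelHom_mem hQ (g n) hv
  · intro hw
    refine ⟨σ.symm w, ?_, σ.apply_symm_apply w⟩
    change coordHom n (σ.symm w) ∈ Q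
    have h1 : coordHom n (σ.symm w) = levelHom (g n)⁻¹ (coordHom n w) := by
      conv_rhs => rw [← σ.apply_symm_apply w, hσ, levelHom_inv_levelHom]
    rw [h1]
    exact levelHom_mem hQ _ hw

theorem map_limitTag_iff {σ : seqGroup ≃+ seqGroup} {g : ℕ → SwapGroup} {π : Equiv.Perm ℕ}
    (hg : SwapConverges g π)
    (hσ : ∀ n w, coordHom n (σ w) = levelHom (g n) (coordHom n w)) (P P' : Set (List ℕ)) :
    (limitTag P).map σ.toAddMonoidHom = limitTag P' ↔ ∀ t, t ∈ P ↔ t.map π ∈ P' := by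
  have hmap : ∀ t : List ℕ, (t.map π.symm).map π = t := fun t => by simp
  have hmap' : ∀ t : List ℕ, (t.map π).map π.symm = t := fun t => by simp
  -- Moving by `σ` moves the eventual value by `π`.
  have key : ∀ w : seqGroup, σ w ∈ limitTag P' ↔ w ∈ limitTag {t | t.map π ∈ P'} := by
    intro w
    obtain ⟨c, hc⟩ := w.2
    have h1 : ∀ᶠ n in Filter.atTop, coordHom n (σ w) = (0, 0, tupleMap π c) := by
      filter_upwards [hg.eventually_levelHom hc] with n hn
      rw [hσ]
      exact hn
    rw [mem_limitTag_iff_of_eventually h1, mem_limitTag_iff_of_eventually hc]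
    have h2 : ∀ t, (tupleMap π c) t = c (t.map π.symm) := fun t => rfl
    constructor
    · intro h t ht
      refine h _ ?_
      rwa [Finsupp.mem_support_iff, h2, hmap', ← Finsupp.mem_support_iff]
    · intro h t ht
      rw [Finsupp.mem_support_iff, h2, ← Finsupp.mem_support_iff] at ht
      have h3 : (t.map π.symm).map π ∈ P' := h _ ht
      rwa [hmap] at h3
  constructor
  · intro h t
    have h1 : t.map π ∈ P' ↔ constTuple t ∈ limitTag {t | t.map π ∈ P'} := by
      rw [constTuple_mem_limitTag, Set.mem_ofPred_eq]
    rw [← constTuple_mem_limitTag (P := P), h1, ← key, ← h]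
    constructor
    · exact fun ht => ⟨_, ht, rfl⟩
    · rintro ⟨w, hw, hwt⟩
      rwa [← σ.injective hwt]
  · intro h
    obtain rfl : P = {t | t.map π ∈ P'} := Set.ext h
    ext w
    constructor
    · rintro ⟨v, hv, rfl⟩
      exact (key v).2 hv
    · intro hw
      refine ⟨σ.symm w, (key _).1 ?_, σ.apply_symm_apply w⟩
      rwa [σ.apply_symm_apply]

/-- Every automorphism of `seqGroup` that fixes all subgroups `coordTag n Q` acts coordinatewise
through a convergent sequence in `SwapGroup`: applied to constant sequences, it must
return eventually constant ones. -/
theorem exists_swapConverges_of_map_coordTag (σ : seqGroup ≃+ seqGroup)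
    (h : ∀ n, ∀ Q ∈ levelTags, (coordTag n Q).map σ.toAddMonoidHom = coordTag n Q) :
    ∃ (g : ℕ → SwapGroup) (π : Equiv.Perm ℕ), SwapConverges g π ∧
      ∀ n w, coordHom n (σ w) = levelHom (g n) (coordHom n w) := by
  have hmem : ∀ n, ∀ Q ∈ levelTags, ∀ w, coordHom n w ∈ Q → coordHom n (σ w) ∈ Q := by
    intro n Q hQ w hw
    have : σ w ∈ (coordTag n Q).map σ.toAddMonoidHom := ⟨w, hw, rfl⟩
    rwa [h n Q hQ] at this
  have hmem' : ∀ n, ∀ Q ∈ levelTags, ∀ w, coordHom n w ∈ Q → coordHom n (σ.symm w) ∈ Q := by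
    intro n Q hQ w hw
    have h1 : w ∈ (coordTag n Q).map σ.toAddMonoidHom := by
      rw [h n Q hQ]
      exact hw
    obtain ⟨v, hv, rfl⟩ := h1
    change coordHom n (σ.symm (σ v)) ∈ Q
    rwa [σ.symm_apply_apply]
  -- The `n`-th coordinate of the image depends only on the `n`-th coordinate.
  have hloc : ∀ τ : seqGroup ≃+ seqGroup,
      (∀ n, ∀ Q ∈ levelTags, ∀ w, coordHom n w ∈ Q → coordHom n (τ w) ∈ Q) →
      ∀ n w, coordHom n (τ (bump n (coordHom n w))) = coordHom n (τ w) := by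
    intro τ hτ n w
    have h1 := hτ n ⊥ (Or.inl (Or.inl (Or.inl rfl))) (bump n (coordHom n w) - w)
      (by rw [map_sub, coordHom_bump, sub_self]; exact zero_mem _)
    rwa [map_sub, map_sub, AddSubgroup.mem_bot, sub_eq_zero] at h1
  have hlevel : ∀ n, ∃ g : SwapGroup, ∀ w, coordHom n (σ w) = levelHom g (coordHom n w) := by
    intro n
    let e : LevelGroup ≃+ LevelGroup :=
      { toFun := fun d => coordHom n (σ (bump n d))
        invFun := fun d => coordHom n (σ.symm (bump n d))
        left_inv := fun d => by
          change coordHom n (σ.symm (bump n (coordHom n (σ (bump n d))))) = d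
          rw [hloc σ.symm hmem', σ.symm_apply_apply, coordHom_bump]
        right_inv := fun d => by
          change coordHom n (σ (bump n (coordHom n (σ.symm (bump n d))))) = d
          rw [hloc σ hmem, σ.apply_symm_apply, coordHom_bump]
        map_add' := fun c d => by rw [map_add, map_add, map_add] }
    obtain ⟨g, hg⟩ := exists_levelHom_of_mapsTo e
      (fun Q hQ d hd => hmem n Q hQ (bump n d) (by rwa [coordHom_bump]))
      (fun Q hQ d hd => hmem' n Q hQ (bump n d) (by rwa [coordHom_bump]))
    exact ⟨g, fun w => by rw [← hloc σ hmem, ← hg]; rfl⟩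
  choose g hg using hlevel
  have hg' : ∀ n w, coordHom n (σ.symm w) = levelHom (g n)⁻¹ (coordHom n w) := fun n w => by
    conv_rhs => rw [← σ.apply_symm_apply w, hg, levelHom_inv_levelHom]
  have hlim : ∀ (τ : seqGroup ≃+ seqGroup) (k : ℕ → SwapGroup),
      (∀ n w, coordHom n (τ w) = levelHom (k n) (coordHom n w)) →
      ∀ x, ∃ y, ∀ᶠ n in Filter.atTop, swapPerm (k n) x = y := by
    intro τ k hk x
    obtain ⟨c, hc⟩ := (τ (constTuple [x])).2
    have h1 : ∀ᶠ n in Filter.atTop, Finsupp.single [swapPerm (k n) x] (1 : ZMod 2) = c := by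
      filter_upwards [hc] with n hn
      have h2 : coordHom n (τ (constTuple [x])) = (0, 0, c) := hn
      rw [hk, coordHom_constTuple, levelHom_apply] at h2
      simpa [tupleMap_single] using h2
    obtain ⟨m, hm⟩ := h1.exists
    refine ⟨swapPerm (k m) x, h1.mono fun n hn => ?_⟩
    have h3 := Finsupp.single_left_injective (one_ne_zero) (hn.trans hm.symm)
    simpa using h3
  choose f hf using hlim σ g hg
  choose f' hf' using hlim σ.symm (fun n => (g n)⁻¹) hg'
  have hl : ∀ x, f' (f x) = x := fun x => by
    obtain ⟨n, h1, h2⟩ := ((hf x).and (hf' (f x))).exists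
    rw [← h2, ← h1, map_inv]
    exact (swapPerm (g n)).symm_apply_apply x
  have hr : ∀ x, f (f' x) = x := fun x => by
    obtain ⟨n, h1, h2⟩ := ((hf' x).and (hf (f' x))).exists
    rw [← h2, ← h1, map_inv]
    exact (swapPerm (g n)).apply_symm_apply x
  exact ⟨g, ⟨f, f', hl, hr⟩, fun x => (hf x).and (hf' x), hg⟩

/-- Two expansions of `(seqGroup, (coordTag n Q))` by subgroups `limitTag (P i)` are isomorphic if
and only if some permutation of `ℕ` carries the sets of tuples to each other. -/
theorem exists_seqGroup_equiv_iff {ι : Type*} (P P' : ι → Set (List ℕ)) :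
    (∃ σ : seqGroup ≃+ seqGroup,
      (∀ n, ∀ Q ∈ levelTags, (coordTag n Q).map σ.toAddMonoidHom = coordTag n Q) ∧
      ∀ i, (limitTag (P i)).map σ.toAddMonoidHom = limitTag (P' i)) ↔
    ∃ π : Equiv.Perm ℕ, ∀ i t, t ∈ P i ↔ t.map π ∈ P' i := by
  constructor
  · rintro ⟨σ, hσ, hP⟩
    obtain ⟨g, π, hg, hσg⟩ := exists_swapConverges_of_map_coordTag σ hσ
    exact ⟨π, fun i => (map_limitTag_iff hg hσg _ _).1 (hP i)⟩
  · rintro ⟨π, hπ⟩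
    obtain ⟨g, hg⟩ := exists_swapPerm_tendsto π
    have hσg : ∀ n w, coordHom n (seqAut g π hg w) = levelHom (g n) (coordHom n w) :=
      fun n w => rfl
    exact ⟨seqAut g π hg, fun n Q hQ => map_coordTag_of_levelHom hσg n hQ,
      fun i => (map_limitTag_iff hg hσg _ _).2 (hπ i)⟩

/-- The subgroups `coordTag n Q` form a countable family, so one sequence `V` lists them all. -/
theorem exists_coordTag_enumeration : ∃ V : ℕ → AddSubgroup seqGroup,
    ∀ σ : seqGroup ≃+ seqGroup, (∀ k, (V k).map σ.toAddMonoidHom = V k) ↔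
      ∀ n, ∀ Q ∈ levelTags, (coordTag n Q).map σ.toAddMonoidHom = coordTag n Q := by
  obtain ⟨Q, hQ⟩ := levelTags_countable.exists_eq_range ⟨⊥, Or.inl (Or.inl (Or.inl rfl))⟩
  refine ⟨fun k => coordTag k.unpair.1 (Q k.unpair.2), fun σ => ⟨fun h n R hR => ?_,
    fun h k => h _ _ (hQ ▸ Set.mem_range_self _)⟩⟩
  rw [hQ] at hR
  obtain ⟨m, rfl⟩ := hR
  simpa using h (Nat.pair n m)

/-! ### The isomorphism type of the sequence group -/

/-- A countably infinite group of exponent two is a direct sum of countably many copies of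
`ZMod 2`. -/
theorem nonempty_addEquiv_directSum_of_add_self (M : Type) [AddCommGroup M] [Countable M]
    [Infinite M] (h : ∀ x : M, x + x = 0) : Nonempty (M ≃+ ⨁ _ : ℕ, ZMod 2) := by
  let _ : Module (ZMod 2) M := AddCommGroup.zmodModule fun x => by rw [two_nsmul, h]
  let b := Module.Basis.ofVectorSpace (ZMod 2) M
  have hc : Countable (Module.Basis.ofVectorSpaceIndex (ZMod 2) M) := b.injective.countable
  have hi : Infinite (Module.Basis.ofVectorSpaceIndex (ZMod 2) M) := by
    by_contra hfin
    rw [not_infinite_iff_finite] at hfin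
    have : Finite (Module.Basis.ofVectorSpaceIndex (ZMod 2) M →₀ ZMod 2) :=
      Finite.of_injective _ DFunLike.coe_injective
    have : Finite M := Finite.of_equiv _ b.repr.toEquiv.symm
    exact not_finite M
  obtain ⟨e⟩ := nonempty_equiv_of_countable (α := Module.Basis.ofVectorSpaceIndex (ZMod 2) M)
    (β := ℕ)
  exact ⟨(b.repr.toAddEquiv.trans (Finsupp.domCongr e)).trans finsuppAddEquivDFinsupp⟩

instance : Countable LevelGroup :=
  have : Countable SwapRing := MonoidAlgebra.coeffEquiv.injective.countable
  inferInstance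

instance : Countable seqGroup := by
  have h : (Set.range fun p : (ℕ →₀ LevelGroup) × TupleSpace =>
      (fun n => p.1 n + (0, 0, p.2) : ℕ → LevelGroup)).Countable := Set.countable_range _
  refine (h.mono ?_).to_subtype
  rintro w ⟨c, hc⟩
  obtain ⟨m, hm⟩ := Filter.eventually_atTop.1 hc
  refine ⟨(Finsupp.ofSupportFinite (fun n => w n - (0, 0, c)) ?_, c), funext fun n => ?_⟩
  · refine (Set.finite_lt_nat m).subset fun n hn => ?_
    by_contra hnm
    refine hn ?_
    change w n - (0, 0, c) = 0
    rw [hm n (not_lt.1 hnm), sub_self]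
  · exact sub_add_cancel (w n) (0, 0, c)

instance : Infinite seqGroup := by
  refine Infinite.of_injective constTuple fun s t h => ?_
  have h1 := congrArg (fun w => (coordHom 0 w).2.2) h
  exact Finsupp.single_left_injective one_ne_zero h1

theorem seqGroup_add_self (w : seqGroup) : w + w = 0 := by
  have hA : ∀ a : SwapRing, a + a = 0 := fun a =>
    MonoidAlgebra.ext (Finsupp.ext fun x => CharTwo.add_self_eq_zero (a.coeff x))
  refine seqGroup_ext fun n => ?_
  rw [map_add, map_zero]
  exact Prod.ext (hA _) (Prod.ext (hA _) (Finsupp.ext fun x => CharTwo.add_self_eq_zero _))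

theorem nonempty_seqGroup_addEquiv : Nonempty (seqGroup ≃+ ⨁ _ : ℕ, ZMod 2) :=
  nonempty_addEquiv_directSum_of_add_self _ seqGroup_add_self

/-! ### Measurability in spaces of structures -/

section Measurability

variable {L : FirstOrder.Language.{0, 0}} {M : Type}

theorem measurableSet_funMap_eq {n : ℕ} (f : L.Functions n) (x : Fin n → M) (y : M) :
    MeasurableSet {S : L.Structure M | S.funMap f x = y} := by
  have : BorelSpace (L.Structure M) := ⟨rfl⟩
  exact IsOpen.measurableSet
    (TopologicalSpace.isOpen_generateFrom_of_mem (Or.inl (Or.inl ⟨n, f, x, y, rfl⟩)))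

theorem measurableSet_relMap {n : ℕ} (R : L.Relations n) (x : Fin n → M) :
    MeasurableSet {S : L.Structure M | S.RelMap R x} := by
  have : BorelSpace (L.Structure M) := ⟨rfl⟩
  exact IsOpen.measurableSet
    (TopologicalSpace.isOpen_generateFrom_of_mem (Or.inl (Or.inr ⟨n, R, x, rfl⟩)))

/-- For a countable language the atomic facts form a countable subbasis, so that a map into the
space of structures is Borel as soon as it pulls atomic facts back to measurable sets. -/
theorem measurable_structure [Countable L.Symbols] [Countable M] {α : Type*} [MeasurableSpace α]
    {F : α → L.Structure M}
    (hf : ∀ n (f : L.Functions n) (x : Fin n → M) (y : M),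
      MeasurableSet {a | (F a).funMap f x = y})
    (hR : ∀ n (R : L.Relations n) (x : Fin n → M), MeasurableSet {a | (F a).RelMap R x}) :
    Measurable F := by
  have hcF : Countable (Σ n, L.Functions n) :=
    (Sum.inl_injective : Function.Injective (Sum.inl : _ → L.Symbols)).countable
  have hcR : Countable (Σ n, L.Relations n) :=
    (Sum.inr_injective : Function.Injective (Sum.inr : _ → L.Symbols)).countable
  have hcFn : ∀ n, Countable (L.Functions n) := fun n =>
    (sigma_mk_injective : Function.Injective (Sigma.mk n : _ → Σ n, L.Functions n)).countable
  have hcRn : ∀ n, Countable (L.Relations n) := fun n =>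
    (sigma_mk_injective : Function.Injective (Sigma.mk n : _ → Σ n, L.Relations n)).countable
  have hc1 : {A : Set (L.Structure M) | ∃ (n : ℕ) (f : L.Functions n) (x : Fin n → M) (y : M),
      A = {S | S.funMap f x = y}}.Countable := by
    refine (Set.countable_range fun p : Σ n, L.Functions n × (Fin n → M) × M =>
      {S : L.Structure M | S.funMap p.2.1 p.2.2.1 = p.2.2.2}).mono ?_
    rintro _ ⟨n, f, x, y, rfl⟩
    exact ⟨⟨n, f, x, y⟩, rfl⟩
  have hc2 : {A : Set (L.Structure M) | ∃ (n : ℕ) (R : L.Relations n) (x : Fin n → M),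
      A = {S | S.RelMap R x}}.Countable := by
    refine (Set.countable_range fun p : Σ n, L.Relations n × (Fin n → M) =>
      {S : L.Structure M | S.RelMap p.2.1 p.2.2}).mono ?_
    rintro _ ⟨n, R, x, rfl⟩
    exact ⟨⟨n, R, x⟩, rfl⟩
  have hc3 : {A : Set (L.Structure M) | ∃ (n : ℕ) (R : L.Relations n) (x : Fin n → M),
      A = {S | ¬ S.RelMap R x}}.Countable := by
    refine (Set.countable_range fun p : Σ n, L.Relations n × (Fin n → M) =>
      {S : L.Structure M | ¬ S.RelMap p.2.1 p.2.2}).mono ?_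
    rintro _ ⟨n, R, x, rfl⟩
    exact ⟨⟨n, R, x⟩, rfl⟩
  have : SecondCountableTopology (L.Structure M) := ⟨⟨_, (hc1.union hc2).union hc3, rfl⟩⟩
  have hborel := borel_eq_generateFrom_of_subbasis (α := L.Structure M) rfl
  change @Measurable α (L.Structure M) _ (borel (L.Structure M)) F
  rw [hborel]
  refine measurable_generateFrom ?_
  rintro _ ((⟨n, f, x, y, rfl⟩ | ⟨n, R, x, rfl⟩) | ⟨n, R, x, rfl⟩)
  · exact hf n f x y
  · exact hR n R x
  · exact (hR n R x).compl

end Measurability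

/-! ### The Borel classes of tagged groups -/

instance (n : ℕ) : Countable (tagLanguage.Functions n) := by
  have : Function.Injective (fun _ : TagFunctions n => ()) := by
    rintro (_ | _) (_ | _) - <;> rfl
  exact this.countable

instance (n : ℕ) : Countable (tagLanguage.Relations n) := by
  have : Function.Injective (fun R : TagRelations n => match R with | .tag i => i) := by
    rintro ⟨i⟩ ⟨j⟩ h
    exact congrArg TagRelations.tag h
  exact this.countable

instance : Countable tagLanguage.Symbols :=
  inferInstanceAs (Countable ((Σ n, tagLanguage.Functions n) ⊕ Σ n, tagLanguage.Relations n))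

/-- The axioms of tagged abelian groups, stated through atomic facts so that they visibly define a
Borel set. -/
def TagAxioms {M : Type} (S : tagLanguage.Structure M) : Prop :=
  (∀ x y z u v : M, S.funMap (n := 2) TagFunctions.add ![x, y] = u →
      S.funMap (n := 2) TagFunctions.add ![y, z] = v → ∀ w,
      S.funMap (n := 2) TagFunctions.add ![x, v] = w →
      S.funMap (n := 2) TagFunctions.add ![u, z] = w) ∧
    (∀ x y z : M, S.funMap (n := 2) TagFunctions.add ![x, y] = z →
      S.funMap (n := 2) TagFunctions.add ![y, x] = z) ∧
    (∀ o x : M, S.funMap (n := 0) TagFunctions.zero ![] = o →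
      S.funMap (n := 2) TagFunctions.add ![o, x] = x) ∧
    (∀ o x : M, S.funMap (n := 0) TagFunctions.zero ![] = o →
      ∃ y : M, S.funMap (n := 2) TagFunctions.add ![y, x] = o) ∧
    ∀ i : ℕ, (∀ o : M, S.funMap (n := 0) TagFunctions.zero ![] = o →
        S.RelMap (n := 1) (TagRelations.tag i) ![o]) ∧
      (∀ x y z : M, S.RelMap (n := 1) (TagRelations.tag i) ![x] →
        S.RelMap (n := 1) (TagRelations.tag i) ![y] →
        S.funMap (n := 2) TagFunctions.add ![x, y] = z →
        S.RelMap (n := 1) (TagRelations.tag i) ![z]) ∧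
      ∀ o x y : M, S.funMap (n := 0) TagFunctions.zero ![] = o →
        S.RelMap (n := 1) (TagRelations.tag i) ![x] →
        S.funMap (n := 2) TagFunctions.add ![y, x] = o →
        S.RelMap (n := 1) (TagRelations.tag i) ![y]

theorem IsTaggedOn.tagAxioms {M : Type} [AddCommGroup M] {S : tagLanguage.Structure M}
    (h : IsTaggedOn S) : TagAxioms S := by
  obtain ⟨h0, ha, ht⟩ := h
  unfold TagAxioms
  simp only [h0, ha]
  refine ⟨?_, ?_, ?_, ?_, fun i => ?_⟩
  · rintro x y z _ _ rfl rfl _ rfl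
    exact add_assoc x y z
  · rintro x y _ rfl
    exact add_comm y x
  · rintro _ x rfl
    exact zero_add x
  · rintro _ x rfl
    exact ⟨-x, neg_add_cancel x⟩
  · obtain ⟨U, hU⟩ := ht i
    simp only [← hU]
    refine ⟨?_, ?_, ?_⟩
    · rintro _ rfl
      exact zero_mem U
    · rintro x y _ hx hy rfl
      exact add_mem hx hy
    · rintro _ x y rfl hx hy
      rw [eq_neg_of_add_eq_zero_left hy]
      exact neg_mem hx

theorem TagAxioms.exists_isTaggedOn {M : Type} {S : tagLanguage.Structure M} (h : TagAxioms S) :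
    ∃ A : AddCommGroup M, @IsTaggedOn M A S := by
  obtain ⟨hassoc, hcomm, hzero, hneg, htag⟩ := h
  choose ng hng using fun x => hneg _ x rfl
  let iAdd : Add M := ⟨fun x y => S.funMap (n := 2) TagFunctions.add ![x, y]⟩
  let iZero : Zero M := ⟨S.funMap (n := 0) TagFunctions.zero ![]⟩
  let iNeg : Neg M := ⟨ng⟩
  let A : AddCommGroup M :=
    { iAdd, iZero, iNeg with
      add_assoc := fun x y z => hassoc x y z _ _ rfl rfl _ rfl
      zero_add := fun x => hzero _ x rfl
      add_zero := fun x => hcomm _ _ _ (hzero _ x rfl)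
      neg_add_cancel := hng
      add_comm := fun x y => (hcomm x y _ rfl).symm
      nsmul := nsmulRec
      zsmul := zsmulRec }
  refine ⟨A, rfl, fun _ _ => rfl, fun i => ?_⟩
  obtain ⟨h0, ha, hn⟩ := htag i
  exact ⟨{ carrier := {x | S.RelMap (n := 1) (TagRelations.tag i) ![x]}
           zero_mem' := h0 _ rfl
           add_mem' := fun hx hy => ha _ _ _ hx hy rfl
           neg_mem' := fun {x} hx => hn _ _ _ rfl hx (hng x) }, fun _ => Iff.rfl⟩

theorem exists_isTaggedOn_iff {M : Type} (S : tagLanguage.Structure M) :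
    (∃ A : AddCommGroup M, @IsTaggedOn M A S) ↔ TagAxioms S :=
  ⟨fun ⟨_, h⟩ => h.tagAxioms, TagAxioms.exists_isTaggedOn⟩

theorem exists_isTaggedOn_isF2Sum_iff {M : Type} [Countable M] [Infinite M]
    (S : tagLanguage.Structure M) :
    (∃ A : AddCommGroup M, @IsTaggedOn M A S ∧ @IsF2Sum M A) ↔
      TagAxioms S ∧ ∀ o x : M, S.funMap (n := 0) TagFunctions.zero ![] = o →
        S.funMap (n := 2) TagFunctions.add ![x, x] = o := by
  constructor
  · rintro ⟨A, hS, ⟨e⟩⟩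
    refine ⟨hS.tagAxioms, ?_⟩
    rintro _ x rfl
    rw [hS.1, hS.2.1]
    refine e.injective ?_
    rw [map_add, map_zero]
    exact DFinsupp.ext fun i => CharTwo.add_self_eq_zero (e x i)
  · rintro ⟨h, h2⟩
    obtain ⟨A, hS⟩ := h.exists_isTaggedOn
    refine ⟨A, hS, nonempty_addEquiv_directSum_of_add_self M fun x => ?_⟩
    rw [← hS.2.1, h2 _ x rfl, hS.1]

theorem measurableSet_tagAxioms (M : Type) [Countable M] :
    MeasurableSet {S : tagLanguage.Structure M | TagAxioms S} := by
  have hf : ∀ n (f : tagLanguage.Functions n) (x : Fin n → M) (y : M),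
      Measurable fun S : tagLanguage.Structure M => S.funMap f x = y := fun n f x y =>
    measurableSet_setOfPred.1 (measurableSet_funMap_eq f x y)
  have hR : ∀ n (R : tagLanguage.Relations n) (x : Fin n → M),
      Measurable fun S : tagLanguage.Structure M => S.RelMap R x := fun n R x =>
    measurableSet_setOfPred.1 (measurableSet_relMap R x)
  refine measurableSet_setOfPred.2 ?_
  unfold TagAxioms
  refine .and (.forall fun x => .forall fun y => .forall fun z => .forall fun u => .forall fun v =>
    (hf _ _ _ _).imp ((hf _ _ _ _).imp (.forall fun w => (hf _ _ _ _).imp (hf _ _ _ _)))) ?_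
  refine .and (.forall fun x => .forall fun y => .forall fun z =>
    (hf _ _ _ _).imp (hf _ _ _ _)) ?_
  refine .and (.forall fun o => .forall fun x => (hf _ _ _ _).imp (hf _ _ _ _)) ?_
  refine .and (.forall fun o => .forall fun x =>
    (hf _ _ _ _).imp (.exists fun y => hf _ _ _ _)) ?_
  refine .forall fun i => .and (.forall fun o => (hf _ _ _ _).imp (hR _ _ _)) (.and ?_ ?_)
  · exact .forall fun x => .forall fun y => .forall fun z =>
      (hR _ _ _).imp ((hR _ _ _).imp ((hf _ _ _ _).imp (hR _ _ _)))
  · exact .forall fun o => .forall fun x => .forall fun y =>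
      (hf _ _ _ _).imp ((hR _ _ _).imp ((hf _ _ _ _).imp (hR _ _ _)))

/-- Transport of the group operations along an isomorphism of structures. -/
theorem IsTaggedOn.exists_of_equiv {M M' : Type} [AddCommGroup M] [S : tagLanguage.Structure M]
    [T : tagLanguage.Structure M'] (e : FirstOrder.Language.Equiv tagLanguage M M') (h : IsTaggedOn S) :
    ∃ A : AddCommGroup M', @IsTaggedOn M' A T ∧ Nonempty (M ≃+ M') := by
  obtain ⟨h0, ha, ht⟩ := h
  let A : AddCommGroup M' := e.toEquiv.symm.addCommGroup
  refine ⟨A, ⟨?_, fun x y => ?_, fun i => ?_⟩, ⟨(e.toEquiv.symm.addEquiv).symm⟩⟩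
  · have h1 := e.map_fun (n := 0) TagFunctions.zero ![]
    rw [Subsingleton.elim (e ∘ ![]) ![]] at h1
    rw [← h1]
    exact congrArg e h0
  · have h1 := e.map_fun (n := 2) TagFunctions.add ![e.symm x, e.symm y]
    have h2 : e ∘ ![e.symm x, e.symm y] = ![x, y] := by
      funext j
      fin_cases j <;> simp
    rw [h2] at h1
    rw [← h1]
    exact congrArg e (ha _ _)
  · obtain ⟨U, hU⟩ := ht i
    refine ⟨U.comap (e.toEquiv.symm.addEquiv : M' ≃+ M).toAddMonoidHom, fun x => ?_⟩
    have h1 := e.map_rel (n := 1) (TagRelations.tag i) ![e.symm x]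
    have h2 : e ∘ ![e.symm x] = ![x] := by
      funext j
      fin_cases j
      simp
    rw [h2] at h1
    exact (hU _).trans h1.symm

theorem IsTaggedOn.exists_isF2Sum_of_equiv {M M' : Type} [AddCommGroup M]
    [S : tagLanguage.Structure M] [T : tagLanguage.Structure M']
    (e : FirstOrder.Language.Equiv tagLanguage M M') (h : IsTaggedOn S) (hM : IsF2Sum M) :
    ∃ A : AddCommGroup M', @IsTaggedOn M' A T ∧ @IsF2Sum M' A := by
  obtain ⟨A, hA, ⟨ψ⟩⟩ := h.exists_of_equiv e
  obtain ⟨φ⟩ := hM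
  exact ⟨A, hA, ⟨ψ.symm.trans φ⟩⟩

theorem isBorelClass_taggedGroups : IsBorelClass taggedGroups where
  measurableSet := by
    convert measurableSet_tagAxioms ℕ using 1
    ext S
    exact exists_isTaggedOn_iff S
  iso_closed := by
    rintro S T ⟨e⟩ ⟨A, hA⟩
    obtain ⟨A', hA', -⟩ := @IsTaggedOn.exists_of_equiv ℕ ℕ A S T e hA
    exact ⟨A', hA'⟩

theorem isBorelClass_taggedF2Groups : IsBorelClass taggedF2Groups where
  measurableSet := by
    have h : MeasurableSet {S : tagLanguage.Structure ℕ | ∀ o x : ℕ,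
        S.funMap (n := 0) TagFunctions.zero ![] = o →
          S.funMap (n := 2) TagFunctions.add ![x, x] = o} :=
      measurableSet_setOfPred.2 (.forall fun o => .forall fun x =>
        (measurableSet_setOfPred.1 (measurableSet_funMap_eq _ _ _)).imp
          (measurableSet_setOfPred.1 (measurableSet_funMap_eq _ _ _)))
    convert (measurableSet_tagAxioms ℕ).inter h using 1
    ext S
    exact exists_isTaggedOn_isF2Sum_iff S
  iso_closed := by
    rintro S T ⟨e⟩ ⟨A, hA, hM⟩
    exact @IsTaggedOn.exists_isF2Sum_of_equiv ℕ ℕ A S T e hA hM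

/-! ### Tagged groups as structures -/

/-- The copy on `X`, along the bijection `e`, of the tagged group `(W, τ)`. -/
@[reducible] def tagStructure {X W : Type} [AddCommGroup W] (e : X ≃ W) (τ : ℕ → AddSubgroup W) :
    tagLanguage.Structure X where
  funMap := fun f => match f with
    | TagFunctions.zero => fun _ => e.symm 0
    | TagFunctions.add => fun x => e.symm (e (x 0) + e (x 1))
  RelMap := fun R => match R with
    | TagRelations.tag i => fun x => e (x 0) ∈ τ i

section TagStructure

variable {X X' W : Type} [AddCommGroup W] (e : X ≃ W) (e' : X' ≃ W) (τ τ' : ℕ → AddSubgroup W)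

theorem tagStructure_exists_isTaggedOn (hW : IsF2Sum W) :
    ∃ A : AddCommGroup X, @IsTaggedOn X A (tagStructure e τ) ∧ @IsF2Sum X A := by
  let A : AddCommGroup X := e.addCommGroup
  obtain ⟨φ⟩ := hW
  exact ⟨A, ⟨rfl, fun _ _ => rfl, fun i =>
    ⟨(τ i).comap (e.addEquiv : X ≃+ W).toAddMonoidHom, fun _ => Iff.rfl⟩⟩, ⟨e.addEquiv.trans φ⟩⟩

theorem nonempty_equiv_tagStructure_iff :
    Nonempty (@FirstOrder.Language.Equiv tagLanguage X X' (tagStructure e τ)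
        (tagStructure e' τ')) ↔
      ∃ σ : W ≃+ W, ∀ i, (τ i).map σ.toAddMonoidHom = τ' i := by
  let S := tagStructure e τ
  let T := tagStructure e' τ'
  constructor
  · rintro ⟨φ⟩
    have hadd : ∀ v w, e' (φ.toEquiv (e.symm (v + w))) =
        e' (φ.toEquiv (e.symm v)) + e' (φ.toEquiv (e.symm w)) := fun v w => by
      have h := congrArg e' (φ.map_fun' (n := 2) TagFunctions.add ![e.symm v, e.symm w])
      have h1 : S.funMap (n := 2) TagFunctions.add ![e.symm v, e.symm w] = e.symm (v + w) := by
        change e.symm (e (e.symm v) + e (e.symm w)) = _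
        simp
      have h2 : ∀ x, e' (T.funMap (n := 2) TagFunctions.add x) = e' (x 0) + e' (x 1) :=
        fun x => e'.apply_symm_apply _
      rw [h2] at h
      exact (congrArg (fun z => e' (φ.toEquiv z)) h1).symm.trans h
    have hrel : ∀ i w, e' (φ.toEquiv (e.symm w)) ∈ τ' i ↔ w ∈ τ i := fun i w => by
      have h := φ.map_rel' (n := 1) (TagRelations.tag i) ![e.symm w]
      have h1 : S.RelMap (n := 1) (TagRelations.tag i) ![e.symm w] ↔ w ∈ τ i := by
        change e (e.symm w) ∈ τ i ↔ _
        simp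
      exact Iff.trans h h1
    refine ⟨{ (e.symm.trans φ.toEquiv).trans e' with map_add' := hadd }, fun i => ?_⟩
    ext w
    constructor
    · rintro ⟨v, hv, rfl⟩
      exact (hrel i v).2 hv
    · intro hw
      have hv : e' (φ.toEquiv (e.symm (e (φ.toEquiv.symm (e'.symm w))))) = w := by simp
      exact ⟨_, (hrel i _).1 (hv.symm ▸ hw), hv⟩
  · rintro ⟨σ, hσ⟩
    refine ⟨⟨(e.trans σ.toEquiv).trans e'.symm, ?_, ?_⟩⟩
    · rintro _ (_ | _) x
      · change e'.symm (σ (e (e.symm 0))) = e'.symm 0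
        simp
      · change e'.symm (σ (e (e.symm (e (x 0) + e (x 1))))) =
          e'.symm (e' (e'.symm (σ (e (x 0)))) + e' (e'.symm (σ (e (x 1)))))
        simp
    · rintro _ ⟨i⟩ x
      change e' (e'.symm (σ (e (x 0)))) ∈ τ' i ↔ e (x 0) ∈ τ i
      rw [← hσ i, Equiv.apply_symm_apply]
      exact AddSubgroup.mem_map_iff_mem (f := σ.toAddMonoidHom) σ.injective

end TagStructure

/-! ### Coding structures by sets of tuples -/

section TupleSet

variable {L : FirstOrder.Language.{0, 0}} {M M' : Type}

/-- The set of tuples coding the interpretation in `S` of a symbol: the graph of a function, with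
the value written first, or the extension of a relation. -/
def tupleSet (S : L.Structure M) : L.Symbols → Set (List M)
  | .inl ⟨_, f⟩ => {t | ∃ x y, S.funMap f x = y ∧ y :: List.ofFn x = t}
  | .inr ⟨_, R⟩ => {t | ∃ x, S.RelMap R x ∧ List.ofFn x = t}

theorem cons_ofFn_mem_tupleSet {S : L.Structure M} {n : ℕ} {f : L.Functions n} {x : Fin n → M}
    {y : M} : y :: List.ofFn x ∈ tupleSet S (.inl ⟨n, f⟩) ↔ S.funMap f x = y := by
  refine ⟨?_, fun h => ⟨x, y, h, rfl⟩⟩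
  rintro ⟨x', y', h, ht⟩
  obtain ⟨rfl, hx⟩ := List.cons.inj ht
  exact List.ofFn_injective hx ▸ h

theorem ofFn_mem_tupleSet {S : L.Structure M} {n : ℕ} {R : L.Relations n} {x : Fin n → M} :
    List.ofFn x ∈ tupleSet S (.inr ⟨n, R⟩) ↔ S.RelMap R x := by
  refine ⟨?_, fun h => ⟨x, h, rfl⟩⟩
  rintro ⟨x', h, hx⟩
  exact List.ofFn_injective hx ▸ h

theorem measurableSet_mem_tupleSet [Countable M] (t : List M) (i : L.Symbols) :
    MeasurableSet {S : L.Structure M | t ∈ tupleSet S i} := by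
  refine measurableSet_setOfPred.2 ?_
  rcases i with ⟨n, f⟩ | ⟨n, R⟩
  · exact .exists fun x => .exists fun y =>
      (measurableSet_setOfPred.1 (measurableSet_funMap_eq f x y)).and measurable_const
  · exact .exists fun x => (measurableSet_setOfPred.1 (measurableSet_relMap R x)).and
      measurable_const

theorem map_mem_tupleSet [S : L.Structure M] [T : L.Structure M']
    (φ : FirstOrder.Language.Equiv L M M') {i : L.Symbols} {t : List M}
    (ht : t ∈ tupleSet S i) : t.map φ.toEquiv ∈ tupleSet T i := by
  rcases i with ⟨n, f⟩ | ⟨n, R⟩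
  · obtain ⟨x, y, rfl, rfl⟩ := ht
    rw [List.map_cons, List.map_ofFn, cons_ofFn_mem_tupleSet]
    exact (φ.map_fun' f x).symm
  · obtain ⟨x, h, rfl⟩ := ht
    rw [List.map_ofFn, ofFn_mem_tupleSet]
    exact (φ.map_rel' R x).2 h

/-- An isomorphism is a bijection that respects all coding sets. -/
theorem nonempty_equiv_iff_exists_map_tupleSet [S : L.Structure M] [T : L.Structure M'] :
    Nonempty (FirstOrder.Language.Equiv L M M') ↔
      ∃ π : M ≃ M', ∀ i t, t ∈ tupleSet S i ↔ t.map π ∈ tupleSet T i := by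
  constructor
  · rintro ⟨φ⟩
    refine ⟨φ.toEquiv, fun i t => ⟨map_mem_tupleSet φ, fun h => ?_⟩⟩
    have h1 := map_mem_tupleSet φ.symm h
    have h2 : (t.map φ.toEquiv).map φ.symm.toEquiv = t := by
      rw [List.map_map]
      exact (List.map_congr_left fun x _ => φ.toEquiv.symm_apply_apply x).trans t.map_id
    exact h2 ▸ h1
  · rintro ⟨π, hπ⟩
    refine ⟨⟨π, fun {n} f x => ?_, fun {n} R x => ?_⟩⟩
    · have h := (hπ (.inl ⟨n, f⟩) (S.funMap f x :: List.ofFn x)).1 (cons_ofFn_mem_tupleSet.2 rfl)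
      rw [List.map_cons, List.map_ofFn, cons_ofFn_mem_tupleSet] at h
      exact h.symm
    · have h := hπ (.inr ⟨n, R⟩) (List.ofFn x)
      rw [List.map_ofFn, ofFn_mem_tupleSet, ofFn_mem_tupleSet] at h
      exact h.symm

end TupleSet

/-! ### Borel completeness -/

/-- If membership of every tuple in `P a` depends measurably on `a`, then so does `limitTag (P a)`:
a sequence has one eventual value, whose support is finite. -/
theorem measurableSet_mem_limitTag {α : Type*} [MeasurableSpace α] {P : α → Set (List ℕ)}
    (hP : ∀ t, MeasurableSet {a | t ∈ P a}) (w : seqGroup) :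
    MeasurableSet {a | w ∈ limitTag (P a)} := by
  obtain ⟨c, hc⟩ := w.2
  have h : {a | w ∈ limitTag (P a)} = ⋂ t ∈ c.support, {a | t ∈ P a} := by
    ext a
    simpa using mem_limitTag_iff_of_eventually (P := P a) hc
  rw [h]
  exact Finset.measurableSet_biInter _ fun t _ => hP t

theorem borelReducible_taggedF2Groups {L : FirstOrder.Language.{0, 0}} [Countable L.Symbols]
    (K : Set (L.Structure ℕ)) : BorelReducible K taggedF2Groups := by
  obtain ⟨V, hV⟩ := exists_coordTag_enumeration
  obtain ⟨s, hs⟩ := exists_surjective_nat (ℕ ⊕ L.Symbols)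
  obtain ⟨e⟩ := nonempty_equiv_of_countable (α := ℕ) (β := seqGroup)
  let τ : L.Structure ℕ → ℕ → AddSubgroup seqGroup := fun S n =>
    Sum.elim V (fun i => limitTag (tupleSet S i)) (s n)
  refine ⟨fun S => ⟨tagStructure e (τ S), tagStructure_exists_isTaggedOn e (τ S)
    nonempty_seqGroup_addEquiv⟩, ?_, fun S T => ?_⟩
  · refine Measurable.subtype_mk (measurable_structure ?_ ?_)
    · rintro _ (_ | _) x y
      · exact MeasurableSet.const (e.symm 0 = y)
      · exact MeasurableSet.const (e.symm (e (x 0) + e (x 1)) = y)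
    · rintro _ ⟨n⟩ x
      have h : ∀ j : ℕ ⊕ L.Symbols, MeasurableSet {S : L.Structure ℕ |
          e (x 0) ∈ Sum.elim V (fun i => limitTag (tupleSet S i)) j} := by
        rintro (k | i)
        · exact MeasurableSet.const (e (x 0) ∈ V k)
        · exact measurableSet_mem_limitTag (fun t => measurableSet_mem_tupleSet t i) _
      exact measurable_subtype_coe (h (s n))
  · refine Iff.trans ?_ (nonempty_equiv_tagStructure_iff e e _ _).symm
    refine Iff.trans (@nonempty_equiv_iff_exists_map_tupleSet L ℕ ℕ S T) ?_
    rw [← exists_seqGroup_equiv_iff]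
    refine exists_congr fun σ => ?_
    rw [← hV σ]
    refine Iff.trans ?_ (hs.forall (p := fun j =>
      (Sum.elim V (fun i => limitTag (tupleSet (S : L.Structure ℕ) i)) j).map σ.toAddMonoidHom =
        Sum.elim V (fun i => limitTag (tupleSet (T : L.Structure ℕ) i)) j))
    exact ⟨fun h => Sum.rec h.1 h.2, fun h => ⟨fun k => h (.inl k), fun i => h (.inr i)⟩⟩

theorem BorelReducible.mono_right {L L' : FirstOrder.Language.{0, 0}} {K : Set (L.Structure ℕ)}
    {K₁ K₂ : Set (L'.Structure ℕ)} (h : BorelReducible K K₁) (h12 : K₁ ⊆ K₂) :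
    BorelReducible K K₂ := by
  obtain ⟨f, hf, hfi⟩ := h
  exact ⟨Set.inclusion h12 ∘ f, (measurable_inclusion h12).comp hf, hfi⟩

theorem taggedF2Groups_subset_taggedGroups : taggedF2Groups ⊆ taggedGroups :=
  fun _ ⟨A, hA, _⟩ => ⟨A, hA⟩

/-! ### Graphs -/

/-- The edges of a graph, as two-element lists. -/
def edgeTuples (G : SimpleGraph ℕ) : Set (List ℕ) :=
  {t | ∃ i j, G.Adj i j ∧ [i, j] = t}

theorem pair_mem_edgeTuples {G : SimpleGraph ℕ} {i j : ℕ} :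
    [i, j] ∈ edgeTuples G ↔ G.Adj i j := by
  simp [edgeTuples]

theorem measurableSet_mem_edgeTuples (t : List ℕ) :
    MeasurableSet {G : SimpleGraph ℕ | t ∈ edgeTuples G} := by
  refine measurableSet_setOfPred.2 (.exists fun i => .exists fun j => .and ?_ measurable_const)
  exact measurable_pi_iff.1 (measurable_pi_iff.1 SimpleGraph.measurable_adj i) j

theorem nonempty_graphIso_iff_exists_perm {G H : SimpleGraph ℕ} :
    Nonempty (G ≃g H) ↔
      ∃ π : Equiv.Perm ℕ, ∀ t, t ∈ edgeTuples G ↔ t.map π ∈ edgeTuples H := by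
  constructor
  · rintro ⟨φ⟩
    refine ⟨φ.toEquiv, fun t => ⟨?_, ?_⟩⟩
    · rintro ⟨i, j, h, rfl⟩
      exact ⟨_, _, φ.map_rel_iff.2 h, rfl⟩
    · rintro ⟨i, j, h, ht⟩
      obtain ⟨a, b, rfl⟩ : ∃ a b, t = [a, b] :=
        List.length_eq_two.1 (by simpa using (congrArg List.length ht).symm)
      refine ⟨a, b, φ.map_rel_iff.1 ?_, rfl⟩
      simp only [List.map_cons, List.map_nil, List.cons.injEq, and_true] at ht
      exact ht.1 ▸ ht.2 ▸ h
  · rintro ⟨π, hπ⟩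
    refine ⟨⟨π, fun {i j} => ?_⟩⟩
    rw [← pair_mem_edgeTuples, ← pair_mem_edgeTuples]
    exact (hπ [i, j]).symm

/-- Transport along `φ` turns maps of subgroups by `σ` into maps by the conjugate `φ ∘ σ ∘ φ⁻¹`. -/
theorem AddSubgroup.map_conj_eq_iff {W W' : Type*} [AddCommGroup W] [AddCommGroup W']
    (φ : W ≃+ W') (σ : W ≃+ W) (P Q : AddSubgroup W) :
    (P.map φ.toAddMonoidHom).map ((φ.symm.trans σ).trans φ).toAddMonoidHom =
      Q.map φ.toAddMonoidHom ↔ P.map σ.toAddMonoidHom = Q := by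
  rw [← (AddSubgroup.map_injective (f := φ.toAddMonoidHom) φ.injective).eq_iff,
    AddSubgroup.map_map, AddSubgroup.map_map]
  have h : ((φ.symm.trans σ).trans φ).toAddMonoidHom.comp φ.toAddMonoidHom =
      φ.toAddMonoidHom.comp σ.toAddMonoidHom := by
    ext x
    simp
  rw [h]

theorem theorem3p1 :
    IsBorelComplete taggedGroups ∧
    IsBorelComplete taggedF2Groups ∧
    -- One fixed tagged group `N = (⨁_ω 𝔽₂, (V n)_n)` and a Borel map `G ↦ (N, U G)` from graphs to
    -- expansions of `N` by one subgroup, preserving isomorphism in both directions.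
    ∃ (V : ℕ → AddSubgroup (⨁ _ : ℕ, ZMod 2))
      (U : SimpleGraph ℕ → AddSubgroup (⨁ _ : ℕ, ZMod 2)),
      (∀ x : ⨁ _ : ℕ, ZMod 2, MeasurableSet {G : SimpleGraph ℕ | x ∈ U G}) ∧
      ∀ G H : SimpleGraph ℕ, Nonempty (G ≃g H) ↔
        ∃ σ : (⨁ _ : ℕ, ZMod 2) ≃+ (⨁ _ : ℕ, ZMod 2),
          (∀ n : ℕ, (V n).map σ.toAddMonoidHom = V n) ∧
          (U G).map σ.toAddMonoidHom = U H := by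
  refine ⟨⟨isBorelClass_taggedGroups, fun L _ K _ =>
      (borelReducible_taggedF2Groups K).mono_right taggedF2Groups_subset_taggedGroups⟩,
    ⟨isBorelClass_taggedF2Groups, fun L _ K _ => borelReducible_taggedF2Groups K⟩, ?_⟩
  obtain ⟨V, hV⟩ := exists_coordTag_enumeration
  obtain ⟨φ⟩ := nonempty_seqGroup_addEquiv
  refine ⟨fun n => (V n).map φ.toAddMonoidHom,
    fun G => (limitTag (edgeTuples G)).map φ.toAddMonoidHom, fun x => ?_, fun G H => ?_⟩
  · have h : ∀ G, x ∈ (limitTag (edgeTuples G)).map φ.toAddMonoidHom ↔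
        φ.symm x ∈ limitTag (edgeTuples G) := fun G =>
      AddSubgroup.mem_map_equiv
    simp only [h]
    exact measurableSet_mem_limitTag measurableSet_mem_edgeTuples _
  · have hcore := exists_seqGroup_equiv_iff (fun _ : Unit => edgeTuples G) fun _ => edgeTuples H
    simp only [← hV, forall_const] at hcore
    rw [nonempty_graphIso_iff_exists_perm, ← hcore]
    refine (Equiv.exists_congr
      (⟨fun σ => (φ.symm.trans σ).trans φ, fun σ => (φ.trans σ).trans φ.symm,
        fun σ => AddEquiv.ext fun x => by simp, fun σ => AddEquiv.ext fun x => by simp⟩ :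
        (seqGroup ≃+ seqGroup) ≃ ((⨁ _ : ℕ, ZMod 2) ≃+ (⨁ _ : ℕ, ZMod 2))) fun σ => ?_)
    simp only [Equiv.coe_fn_mk, AddSubgroup.map_conj_eq_iff]
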